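/- Let $\mathtt l,\mathtt r\ge 1$ and $n,m\ge 0$ be integers with $n\mathtt l=m\mathtt r$. A pooling graph is a bipartite multigraph with $n$ left nodes (items) and $m$ right nodes (tests). The $(\mathtt l,\mathtt r)$-regular ensemble is the following random pooling graph: every item has $\mathtt l$ edge ends, every test has $\mathtt r$ edge ends, and the $n\mathtt l$ edge ends of the items are matched with the $m\mathtt r$ edge ends of the tests by a bijection drawn uniformly at random among all $(n\mathtt l)!$ bijections. A pattern is a set $\mathcal I$ of items, called defective. A test is positive if at least one of its edges leads to a defective item, and negative otherwise. An item with at least one edge to a negative test is definitely non-defective (DND); every other item is possibly defective (PD). Under definite defective (DD) detection, a PD item is declared defective if and only if it is joined by an edge to a positive test exactly one of whose edges (counted with multiplicity), namely this one, leads to a PD item. A misdetection is a defective item that is not declared defective. For integers $i,j\ge 0$ let $A_{i+j,j}$ be the average, over the ensemble, of the number of patterns with $i+j$ defective items and exactly $j$ misdetections. Let \begin{align*} f_1(s_1)&=(1+s_1)^{\mathtt l}-s_1^{\mathtt l},\\ f_2(s_2,s_3)&=(1+s_2+s_3)^{\mathtt l}-(s_2+s_3)^{\mathtt l},\\ g(x_1,x_2,x_3)&=(1+x_1+x_2+x_3)^{\mathtt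 r}-(x_1+x_2)^{\mathtt r}-\mathtt r\,x_1^{\mathtt r-1}-\mathtt r\,x_3x_1^{\mathtt r-1}, \end{align*} write $\mathrm{coeff}(p,\mu)$ for the coefficient of the monomial $\mu$ in the polynomial $p$, write $\binom{a_1+\dots+a_q}{a_1,\dots,a_q}$ for multinomial coefficients, and put $w=b_2\mathtt r+b_1-(i+j+k)\mathtt l$. Then \begin{align*} A_{i+j,j}=\sum_{k,b_1,b_2}&\binom{n}{i,j,k,n-i-j-k}\binom{m}{b_1,b_2,m-b_1-b_2}\,\mathrm{coeff}\!\left(f_1(s_1)^i,\,s_1^{i\mathtt l-b_1}\right)\mathtt r^{b_1}\\ &\times\mathrm{coeff}\!\left(f_2(s_2,s_3)^{n-i-j-k},\,s_2^{w}s_3^{b_1(\mathtt r-1)}\right)\\ &\times\frac{\mathrm{coeff}\!\left(g(x_1,x_2,x_3)^{b_2},\,x_1^{w}x_2^{k\mathtt l}x_3^{i\mathtt l-b_1}\right)}{\binom{n\mathtt l}{(m-b_1-b_2)\mathtt r,\;j\mathtt l,\;w,\;b_1(\mathtt r-1),\;k\mathtt l,\;i\mathtt l-b_1,\;b_1}},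 \end{align*} where the sum is over all integers $k,b_1,b_2\ge 0$ with $i+j+k\le n$, $\;i\le b_1\le i\mathtt l$, $\;b_1(\mathtt r-1)\le (n-i-j-k)\mathtt l$, $\;b_1+b_2\le\min\{m,(i+j)\mathtt l\}$, $\;(i+j+k)\mathtt l\le b_2\mathtt r+b_1$ and $\;n-i-j-k\le (m-b_1-b_2)\mathtt r$. -/

import Mathlib

/-- A pooling graph: a bipartite multigraph with left nodes `V` (items), right nodes `C` (tests)
and edges `E`; the edge `e` joins the item `left e` to the test `right e`. -/
structure PoolingGraph (V C E : Type*) where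
  left : E → V
  right : E → C

namespace PoolingGraph

variable {V C E : Type*} (G : PoolingGraph V C E) (I : Finset V)

/-- A test is positive if it is joined to at least one defective item; `I` is the set of
defective items. -/
def IsPositive (c : C) : Prop := ∃ e, G.right e = c ∧ G.left e ∈ I

/-- An item is definitely non-defective if it is joined to at least one negative test. -/
def IsDND (v : V) : Prop := ∃ e, G.left e = v ∧ ¬ G.IsPositive I (G.right e)

/-- The remaining items are possibly defective. -/
def IsPD (v : V) : Prop := ¬ G.IsDND I v

/-- An item is declared defective by the DD detector if it is possibly defective and is joined by
an edge `e` to a positive test that contains exactly one possible defective, edges being counted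
with multiplicity: `e` is the only edge of that test whose left end is possibly defective. -/
def IsDD (v : V) : Prop :=
  G.IsPD I v ∧ ∃ e, G.left e = v ∧ G.IsPositive I (G.right e) ∧
    ∀ e', G.right e' = G.right e → G.IsPD I (G.left e') → e' = e

open Classical in
/-- The misdetected items: defective, but not declared defective by the DD detector. -/
noncomputable def misdetected : Finset V := I.filter fun v => ¬ G.IsDD I v

open Classical in
/-- The number of patterns (sets of defective items) with `a` defective items and `j`
misdetections in the pooling graph `G`, under DD detection. -/
noncomputable def numPatternsDD [Fintype V] (a j : ℕ) : ℕ :=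
  (Finset.univ.filter fun I : Finset V => I.card = a ∧ (G.misdetected I).card = j).card

/-- The `(l, r)`-regular pooling graph given by a perfect matching `σ` of the `l` edge ends of each
of the `n` left nodes with the `r` edge ends of each of the `m` right nodes. -/
def ofMatching {n m l r : ℕ} (σ : Fin n × Fin l ≃ Fin m × Fin r) :
    PoolingGraph (Fin n) (Fin m) (Fin n × Fin l) where
  left e := e.1
  right e := (σ e).1

/-- Every left node has degree `l`. -/
theorem ofMatching_left_degree {n m l r : ℕ} (σ : Fin n × Fin l ≃ Fin m × Fin r) (v : Fin n) :
    Nat.card {e // (ofMatching σ).left e = v} = l := by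
  have h : Nat.card {e : Fin n × Fin l // e.1 = v} = Nat.card (Fin l) :=
    Nat.card_congr ⟨fun e => e.1.2, fun a => ⟨(v, a), rfl⟩,
      by rintro ⟨⟨w, a⟩, rfl⟩; rfl, fun _ => rfl⟩
  simpa [ofMatching] using h

/-- Every right node has degree `r`. -/
theorem ofMatching_right_degree {n m l r : ℕ} (σ : Fin n × Fin l ≃ Fin m × Fin r) (c : Fin m) :
    Nat.card {e // (ofMatching σ).right e = c} = r := by
  have h : Nat.card {e : Fin n × Fin l // (σ e).1 = c} = Nat.card (Fin r) :=
    Nat.card_congr ⟨fun e => (σ e.1).2, fun a => ⟨σ.symm (c, a), by simp⟩,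
      by rintro ⟨e, rfl⟩; simp, fun _ => by simp⟩
  simpa [ofMatching] using h

end PoolingGraph

/-- The average, over a pooling graph drawn uniformly at random from the `(l, r)`-regular ensemble
with `n` left and `m` right nodes (all `(n l)!` matchings of edge ends equally likely), of the
number of patterns with `a` defective items and `j` misdetections under DD detection. -/
noncomputable def avgEnumeratorDD (n m l r a j : ℕ) : ℚ :=
  (∑ σ : Fin n × Fin l ≃ Fin m × Fin r, ((PoolingGraph.ofMatching σ).numPatternsDD a j : ℚ)) /
    (Fintype.card (Fin n × Fin l ≃ Fin m × Fin r) : ℚ)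

/-- `f₁(s₁) = (1 + s₁)^l - s₁^l`. -/
noncomputable def polyF₁ (l : ℕ) : Polynomial ℤ :=
  (1 + Polynomial.X) ^ l - Polynomial.X ^ l

/-- `f₂(s₂, s₃) = (1 + s₂ + s₃)^l - (s₂ + s₃)^l`; the variables `0`, `1` are `s₂`, `s₃`. -/
noncomputable def polyF₂ (l : ℕ) : MvPolynomial (Fin 2) ℤ :=
  (1 + MvPolynomial.X 0 + MvPolynomial.X 1) ^ l - (MvPolynomial.X 0 + MvPolynomial.X 1) ^ l

/-- `g(x₁, x₂, x₃) = (1 + x₁ + x₂ + x₃)^r - (x₁ + x₂)^r - r x₁^(r-1) - r x₃ x₁^(r-1)`;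
the variables `0`, `1`, `2` are `x₁`, `x₂`, `x₃`. -/
noncomputable def polyG (r : ℕ) : MvPolynomial (Fin 3) ℤ :=
  (1 + MvPolynomial.X 0 + MvPolynomial.X 1 + MvPolynomial.X 2) ^ r
    - (MvPolynomial.X 0 + MvPolynomial.X 1) ^ r
    - (r : MvPolynomial (Fin 3) ℤ) * MvPolynomial.X 0 ^ (r - 1)
    - (r : MvPolynomial (Fin 3) ℤ) * MvPolynomial.X 2 * MvPolynomial.X 0 ^ (r - 1)

/-- The index set of the sum: all triples `(k, b₁, b₂)` of natural numbers with
`i + j + k ≤ n`, `i ≤ b₁ ≤ min {i l, (n - i - j - k) l / (r - 1)}`,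
`b₁ + b₂ ≤ min {m, (i + j) l}`, `(i + j + k) l ≤ b₂ r + b₁` and
`n - i - j - k ≤ (m - b₁ - b₂) r`.
(The ranges lose nothing, as `k ≤ n` and `b₁ + b₂ ≤ m`; no subtraction below is truncated.) -/
def indexSetDD (n m l r i j : ℕ) : Finset (ℕ × ℕ × ℕ) :=
  (Finset.range (n + 1) ×ˢ Finset.range (m + 1) ×ˢ Finset.range (m + 1)).filter
    fun (k, b₁, b₂) =>
      i + j + k ≤ n ∧
      i ≤ b₁ ∧ b₁ ≤ i * l ∧ b₁ * (r - 1) ≤ (n - i - j - k) * l ∧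
      b₁ + b₂ ≤ m ∧ b₁ + b₂ ≤ (i + j) * l ∧
      (i + j + k) * l ≤ b₂ * r + b₁ ∧
      n - i - j - k ≤ (m - b₁ - b₂) * r

/-! For a fixed graph, a pattern is the same thing as a consistent labelling of items by four
classes and of tests by three, where consistency is a local condition at each node: running the
detector on a pattern yields such a labelling, and the local conditions force any consistent
labelling to be the one produced by its defective items
(`PoolingGraph.numPatternsDD_eq_card_labellings`). The expected number of patterns is therefore the
sum, over all labellings with `i` items of class `0` and `j` of class `1`, of the probability that a
random matching is consistent with the labelling.

Fix a labelling. Choose for every edge end the class expected at its other end, so that the rows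
satisfy the local conditions. Every edge end then carries a pair (item class, test class), and a
matching realises the choice exactly when it preserves these pairs. Such matchings exist only if
each pair occurs equally often on both sides, and then their number is the product of the factorials
of these multiplicities (`card_matchings_isLabelling`). Only seven pairs can occur, and the class
sizes `i, j, k, b₁, b₂` determine all multiplicities (`counts_eq_iff`): these are the seven entries
of the multinomial coefficient in the denominator, which appears after division by `(n l)!`.

The choices of rows with prescribed multiplicities are counted by coefficients of products of row
generating functions: `f₁` and `f₂` for items of classes `0` and `3`, and `r` and `g` for tests of
classes `0` and `1` (`card_itemRows`, `card_testRows`). The labellings with given class sizes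
contribute the two multinomial coefficients in the numerator (`card_labellings`). -/

/-- The local condition at an item of class `c` whose edges lead to tests of the classes `x`.
Item classes: `0` detected defective, `1` misdetected, `2` possibly defective but not defective,
`3` definitely non-defective. Test classes: `0` positive with a single edge to a possibly
defective item, `1` any other positive test, `2` negative. -/
def IsItemRow {S : Type*} (c : Fin 4) (x : S → Fin 3) : Prop :=
  match c with
  | 0 => (∀ s, x s ≠ 2) ∧ ∃ s, x s = 0
  | 1 => ∀ s, x s = 1
  | 2 => ∀ s, x s = 1
  | 3 => ∃ s, x s = 2

/-- The local condition at a test of class `c` whose edges lead to items of the classes `y`. -/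
def IsTestRow {S : Type*} (c : Fin 3) (y : S → Fin 4) : Prop :=
  match c with
  | 0 => ∃ s, y s = 0 ∧ ∀ s', s' ≠ s → y s' = 3
  | 1 => (∃ s, y s = 0 ∨ y s = 1) ∧ ¬ ∃ s, ∀ s', s' ≠ s → y s' = 3
  | 2 => ∀ s, y s = 3

theorem isItemRow_comp_equiv {S T : Type*} (f : S ≃ T) (c : Fin 4) (x : T → Fin 3) :
    IsItemRow c (fun s => x (f s)) ↔ IsItemRow c x := by
  fin_cases c <;> simp only [IsItemRow, f.surjective.forall, f.surjective.exists]

theorem isTestRow_comp_equiv {S T : Type*} (f : S ≃ T) (c : Fin 3) (y : T → Fin 4) :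
    IsTestRow c (fun s => y (f s)) ↔ IsTestRow c y := by
  fin_cases c <;>
    simp only [IsTestRow, f.surjective.forall, f.surjective.exists, f.injective.ne_iff]

/-! ### Patterns correspond to consistent labellings -/

namespace PoolingGraph

variable {V C E : Type*} (G : PoolingGraph V C E)

/-- `p` labels every item and every test by a class, consistently with the edges of `G`. -/
def IsLabelling (p : (V → Fin 4) × (C → Fin 3)) : Prop :=
  (∀ v, IsItemRow (p.1 v) fun e : {e // G.left e = v} => p.2 (G.right e)) ∧
    ∀ c, IsTestRow (p.2 c) fun e : {e // G.right e = c} => p.1 (G.left e)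

/-- The set of items whose class in the labelling `p` is that of a defective item. -/
def patternOf [Fintype V] (p : (V → Fin 4) × (C → Fin 3)) : Finset V :=
  Finset.univ.filter fun v => p.1 v = 0 ∨ p.1 v = 1

section Labelling

variable {G} {p : (V → Fin 4) × (C → Fin 3)}

/-- The row condition of class `1` contains the negation of the right-hand side, so among positive
tests the item classes alone decide between `0` and `1`. -/
theorem IsLabelling.test_eq_zero_iff (h : G.IsLabelling p) {c : C} (hc : p.2 c ≠ 2) :
    p.2 c = 0 ↔ ∃ s : {e // G.right e = c}, ∀ s', s' ≠ s → p.1 (G.left s'.1) = 3 := by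
  have hr := h.2 c
  generalize hx : p.2 c = x at *
  fin_cases x
  · obtain ⟨s, -, hs⟩ := hr
    simpa using ⟨s.1, s.2, fun a ha => hs ⟨a, ha⟩ ∘ (by simp [Subtype.ext_iff])⟩
  · simpa using hr.2
  · simp at hc

variable [Fintype V]

theorem mem_patternOf {v : V} : v ∈ patternOf p ↔ p.1 v = 0 ∨ p.1 v = 1 := by
  simp [patternOf]

theorem IsLabelling.isPositive_iff (h : G.IsLabelling p) (c : C) :
    G.IsPositive (patternOf p) c ↔ p.2 c ≠ 2 := by
  have hc := h.2 c
  constructor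
  · rintro ⟨e, rfl, he⟩ h2
    rw [h2] at hc
    have := hc ⟨e, rfl⟩
    rw [mem_patternOf] at he
    simp only at this
    rw [this] at he
    simp at he
  · intro h2
    generalize hx : p.2 c = x at *
    fin_cases x
    · obtain ⟨⟨e, he⟩, h0, -⟩ := hc
      exact ⟨e, he, mem_patternOf.2 (Or.inl h0)⟩
    · obtain ⟨⟨⟨e, he⟩, h0⟩, -⟩ := hc
      exact ⟨e, he, mem_patternOf.2 h0⟩
    · simp at h2

theorem IsLabelling.isPD_iff (h : G.IsLabelling p) (v : V) :
    G.IsPD (patternOf p) v ↔ p.1 v ≠ 3 := by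
  rw [IsPD, not_iff_not, IsDND]
  simp only [h.isPositive_iff, not_not]
  have hv := h.1 v
  generalize hx : p.1 v = x at *
  fin_cases x
  · obtain ⟨h1, -⟩ := hv
    simpa using fun e he => h1 ⟨e, he⟩
  · have h1 : ∀ e (he : G.left e = v), p.2 (G.right e) = 1 := fun e he => hv ⟨e, he⟩
    simp +contextual [h1]
  · have h1 : ∀ e (he : G.left e = v), p.2 (G.right e) = 1 := fun e he => hv ⟨e, he⟩
    simp +contextual [h1]
  · obtain ⟨⟨e, he⟩, h1⟩ := hv
    simpa using ⟨e, he, h1⟩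

/-- An item of class `0` has an edge to a test of class `0`, whose other edges all lead to class
`3`, that is, to DND items. An item of class `1` has edges only to tests of class `1`, and none of
these has a single edge that accounts for all its PD ends. -/
theorem IsLabelling.not_isDD_iff (h : G.IsLabelling p) {v : V} (hv : v ∈ patternOf p) :
    ¬ G.IsDD (patternOf p) v ↔ p.1 v = 1 := by
  have hr := h.1 v
  rcases mem_patternOf.1 hv with h0 | h1
  · rw [h0] at hr ⊢
    obtain ⟨-, ⟨e, he⟩, h2⟩ := hr
    simp only at h2
    simp only [zero_ne_one, iff_false, not_not]
    refine ⟨(h.isPD_iff v).2 (by simp [h0]), e, he, (h.isPositive_iff _).2 (by simp [h2]), ?_⟩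
    intro e' he' hpd
    have hc := h.2 (G.right e)
    rw [h2] at hc
    obtain ⟨s, -, hs⟩ := hc
    rw [h.isPD_iff] at hpd
    have a1 : (⟨e', he'⟩ : {x // G.right x = G.right e}) = s := by
      by_contra hne
      exact hpd (hs _ hne)
    have a2 : (⟨e, rfl⟩ : {x // G.right x = G.right e}) = s := by
      by_contra hne
      have := hs _ hne
      simp [he, h0] at this
    simpa using congrArg Subtype.val (a1.trans a2.symm)
  · rw [h1] at hr ⊢
    simp only [iff_true]
    rintro ⟨-, e, he, -, huniq⟩
    have h2 := hr ⟨e, he⟩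
    simp only at h2
    have hc := h.2 (G.right e)
    rw [h2] at hc
    refine hc.2 ⟨⟨e, rfl⟩, fun s hs => ?_⟩
    by_contra h3
    exact hs (Subtype.ext (huniq s.1 s.2 ((h.isPD_iff _).2 h3)))

theorem IsLabelling.misdetected_eq (h : G.IsLabelling p) :
    G.misdetected (patternOf p) = Finset.univ.filter fun v => p.1 v = 1 := by
  ext v
  simp only [misdetected, Finset.mem_filter, Finset.mem_univ, true_and]
  constructor
  · exact fun hv => (h.not_isDD_iff hv.1).1 hv.2
  · intro hv
    have : v ∈ patternOf p := mem_patternOf.2 (Or.inr hv)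
    exact ⟨this, (h.not_isDD_iff this).2 hv⟩

/-- Misdetection, being PD and positivity depend on the pattern only; together they recover every
item class, and then every test class. -/
theorem IsLabelling.patternOf_injOn :
    Set.InjOn patternOf {p : (V → Fin 4) × (C → Fin 3) | G.IsLabelling p} := by
  intro p hp q hq hpq
  have h1 : p.1 = q.1 := by
    funext v
    have a1 : p.1 v = 1 ↔ q.1 v = 1 := by
      have := hp.misdetected_eq.symm.trans ((congrArg G.misdetected hpq).trans hq.misdetected_eq)
      simpa using congrArg (v ∈ ·) this
    have a0 : (p.1 v = 0 ∨ p.1 v = 1) ↔ (q.1 v = 0 ∨ q.1 v = 1) := by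
      rw [← mem_patternOf, ← mem_patternOf, hpq]
    have a3 : p.1 v ≠ 3 ↔ q.1 v ≠ 3 := by
      rw [← hp.isPD_iff, ← hq.isPD_iff, hpq]
    omega
  refine Prod.ext h1 (funext fun c => ?_)
  have b2 : p.2 c ≠ 2 ↔ q.2 c ≠ 2 := by
    rw [← hp.isPositive_iff, ← hq.isPositive_iff, hpq]
  by_cases hc : p.2 c = 2
  · rw [hc, not_not.1 (fun h => b2.2 h hc)]
  · have b0 : p.2 c = 0 ↔ q.2 c = 0 := by
      rw [hp.test_eq_zero_iff hc, hq.test_eq_zero_iff (b2.1 hc), h1]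
    have := b2.1 hc
    omega

end Labelling

open Classical in
/-- The labelling of items and tests determined by the set `I` of defective items. -/
noncomputable def labelling (I : Finset V) : (V → Fin 4) × (C → Fin 3) :=
  (fun v => if v ∈ I then (if G.IsDD I v then 0 else 1) else if G.IsPD I v then 2 else 3,
   fun c => if G.IsPositive I c then
      (if ∃ e, G.right e = c ∧ ∀ e', G.right e' = c → G.IsPD I (G.left e') → e' = e
        then 0 else 1)
      else 2)

theorem isPD_of_mem {I : Finset V} {v : V} (hv : v ∈ I) : G.IsPD I v := by
  rintro ⟨e, rfl, he⟩
  exact he ⟨e, rfl, hv⟩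

theorem patternOf_labelling [Fintype V] (I : Finset V) : patternOf (G.labelling I) = I := by
  ext v
  rw [mem_patternOf]
  simp only [labelling]
  split_ifs <;> simp_all

theorem isLabelling_labelling (I : Finset V) : G.IsLabelling (G.labelling I) := by
  constructor
  · intro v
    have hpos : G.IsPD I v → ∀ e, G.left e = v → G.IsPositive I (G.right e) := by
      intro h e he
      by_contra hn
      exact h ⟨e, he, hn⟩
    by_cases hv : v ∈ I
    · have hpos := hpos (G.isPD_of_mem hv)
      by_cases hd : G.IsDD I v
      · have : (G.labelling I).1 v = 0 := by simp [labelling, hv, hd]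
        rw [this]
        refine ⟨?_, ?_⟩
        · rintro ⟨e, he⟩
          simp only [labelling, hpos e he, if_true]
          split_ifs <;> simp
        · obtain ⟨-, e, he, h1, h2⟩ := hd
          refine ⟨⟨e, he⟩, ?_⟩
          simp only [labelling, h1, if_true]
          exact if_pos ⟨e, rfl, h2⟩
      · have : (G.labelling I).1 v = 1 := by simp [labelling, hv, hd]
        rw [this]
        rintro ⟨e, he⟩
        simp only [labelling, hpos e he, if_true]
        refine if_neg ?_
        rintro ⟨e₀, h0, h1⟩
        obtain rfl : e = e₀ := h1 e rfl (he ▸ G.isPD_of_mem hv)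
        exact hd ⟨G.isPD_of_mem hv, e, he, hpos e he, h1⟩
    · by_cases hd : G.IsPD I v
      · have : (G.labelling I).1 v = 2 := by simp [labelling, hv, hd]
        rw [this]
        rintro ⟨e, he⟩
        simp only [labelling, hpos hd e he, if_true]
        refine if_neg ?_
        rintro ⟨e₀, h0, h1⟩
        obtain rfl : e = e₀ := h1 e rfl (he ▸ hd)
        -- The positive test has an edge to a defective item, which is PD; by uniqueness this edge
        -- is `e`, so `v` itself would be defective.
        obtain ⟨e', he', hI⟩ := hpos hd e he
        obtain rfl : e' = e := h1 e' he' (G.isPD_of_mem hI)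
        exact hv (he ▸ hI)
      · have : (G.labelling I).1 v = 3 := by simp [labelling, hv, hd]
        rw [this]
        obtain ⟨e, he, hn⟩ := not_not.1 hd
        exact ⟨⟨e, he⟩, by simp [labelling, hn]⟩
  · intro c
    have hthree : ∀ v, ¬ G.IsPD I v → (G.labelling I).1 v = 3 := by
      intro v h
      simp [labelling, h, mt G.isPD_of_mem h]
    have hthree' : ∀ v, (G.labelling I).1 v = 3 → ¬ G.IsPD I v := by
      intro v
      simp only [labelling]
      split_ifs <;> simp_all
    by_cases hc : G.IsPositive I c
    · by_cases hu : ∃ e, G.right e = c ∧ ∀ e', G.right e' = c → G.IsPD I (G.left e') → e' = e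
      · have : (G.labelling I).2 c = 0 := by simp only [labelling, if_pos hc, if_pos hu]
        rw [this]
        obtain ⟨e, rfl, he⟩ := hu
        refine ⟨⟨e, rfl⟩, ?_, ?_⟩
        · obtain ⟨e', he', hI⟩ := id hc
          obtain rfl := he e' he' (G.isPD_of_mem hI)
          have : G.IsDD I (G.left e') := ⟨G.isPD_of_mem hI, e', rfl, hc, he⟩
          simp [labelling, hI, this]
        · rintro ⟨e', he'⟩ hne
          refine hthree _ fun hpd => hne (Subtype.ext (he e' he' hpd))
      · have : (G.labelling I).2 c = 1 := by simp only [labelling, if_pos hc, if_neg hu]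
        rw [this]
        refine ⟨?_, ?_⟩
        · obtain ⟨e, he, hI⟩ := hc
          refine ⟨⟨e, he⟩, ?_⟩
          by_cases hd : G.IsDD I (G.left e) <;> simp [labelling, hI, hd]
        · rintro ⟨⟨e, he⟩, h⟩
          refine hu ⟨e, he, fun e' he' hpd => ?_⟩
          by_contra hne
          exact hthree' _ (h ⟨e', he'⟩ (by simpa using hne)) hpd
    · have : (G.labelling I).2 c = 2 := by simp only [labelling, if_neg hc]
      rw [this]
      rintro ⟨e, rfl⟩
      exact hthree _ fun hpd => hpd ⟨e, rfl, hc⟩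

open Classical in
theorem numPatternsDD_eq_card_labellings [Fintype V] [Fintype C] (i j : ℕ) :
    G.numPatternsDD (i + j) j =
      (Finset.univ.filter fun p : (V → Fin 4) × (C → Fin 3) => G.IsLabelling p ∧
        (Finset.univ.filter fun v => p.1 v = 0).card = i ∧
        (Finset.univ.filter fun v => p.1 v = 1).card = j).card := by
  have key : ∀ p : (V → Fin 4) × (C → Fin 3), (patternOf p).card =
      (Finset.univ.filter fun v => p.1 v = 0).card +
        (Finset.univ.filter fun v => p.1 v = 1).card := by
    intro p
    rw [patternOf, Finset.filter_or, Finset.card_union_of_disjoint]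
    exact Finset.disjoint_filter.2 (by simp +contextual)
  symm
  refine Finset.card_bij (fun p _ => patternOf p) ?_ ?_ ?_
  · intro p hp
    simp only [Finset.mem_filter, Finset.mem_univ, true_and] at hp ⊢
    rw [hp.1.misdetected_eq, key]
    omega
  · intro p hp q hq
    simp only [Finset.mem_filter, Finset.mem_univ, true_and] at hp hq
    exact IsLabelling.patternOf_injOn hp.1 hq.1
  · intro I hI
    simp only [Finset.mem_filter, Finset.mem_univ, true_and] at hI
    refine ⟨G.labelling I, ?_, G.patternOf_labelling I⟩
    have h := G.isLabelling_labelling I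
    have h1 := h.misdetected_eq
    have h2 := key (G.labelling I)
    rw [patternOf_labelling] at h1 h2
    simp only [Finset.mem_filter, Finset.mem_univ, true_and]
    rw [h1] at hI
    exact ⟨h, by omega, hI.2⟩

theorem isLabelling_ofMatching_iff {n m l r : ℕ} (σ : Fin n × Fin l ≃ Fin m × Fin r)
    (p : (Fin n → Fin 4) × (Fin m → Fin 3)) :
    (ofMatching σ).IsLabelling p ↔
      (∀ v, IsItemRow (p.1 v) fun s : Fin l => p.2 (σ (v, s)).1) ∧
        ∀ c, IsTestRow (p.2 c) fun s : Fin r => p.1 (σ.symm (c, s)).1 := by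
  refine and_congr (forall_congr' fun v => ?_) (forall_congr' fun c => ?_)
  · let f : Fin l ≃ {e // (ofMatching σ).left e = v} :=
      ⟨fun a => ⟨(v, a), rfl⟩, fun e => e.1.2, fun _ => rfl,
        by rintro ⟨⟨w, a⟩, rfl⟩; rfl⟩
    exact (isItemRow_comp_equiv f _ _).symm
  · let f : Fin r ≃ {e // (ofMatching σ).right e = c} :=
      ⟨fun a => ⟨σ.symm (c, a), by simp [ofMatching]⟩, fun e => (σ e.1).2, fun _ => by simp,
        by rintro ⟨e, rfl⟩; simp [ofMatching]⟩
    exact (isTestRow_comp_equiv f _ _).symm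

end PoolingGraph

/-! ### Functions and bijections with prescribed fibres -/

open scoped Nat

/-- The number of points at which `p` takes the value `t`. -/
def fiberCard {X T : Type*} [Fintype X] [DecidableEq T] (p : X → T) (t : T) : ℕ :=
  (Finset.univ.filter fun x => p x = t).card

theorem sum_fiberCard {X T : Type*} [Fintype X] [Fintype T] [DecidableEq T] (p : X → T) :
    ∑ t, fiberCard p t = Fintype.card X :=
  (Finset.card_eq_sum_card_fiberwise fun _ _ => Finset.mem_coe.2 (Finset.mem_univ _)).symm

theorem prod_comp_eq_prod_pow_fiberCard {X T M : Type*} [Fintype X] [Fintype T] [DecidableEq T]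
    [CommMonoid M] (p : X → T) (w : T → M) : ∏ x, w (p x) = ∏ t, w t ^ fiberCard p t := by
  simp_rw [fiberCard, ← Finset.prod_const]
  exact (Finset.prod_fiberwise' _ _ _).symm

theorem exists_equiv_comp_eq {X Y T : Type*} [Fintype X] [Fintype Y] [DecidableEq T]
    (p : X → T) (q : Y → T) (h : ∀ t, fiberCard p t = fiberCard q t) :
    ∃ σ : X ≃ Y, q ∘ σ = p := by
  have e : ∀ t, Nonempty ({x // p x = t} ≃ {y // q y = t}) := fun t => by
    refine Fintype.card_eq.1 ?_
    rw [Fintype.card_subtype, Fintype.card_subtype]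
    exact h t
  let f : X ≃ Y := (Equiv.sigmaFiberEquiv p).symm.trans
    ((Equiv.sigmaCongrRight fun t => (e t).some).trans (Equiv.sigmaFiberEquiv q))
  refine ⟨f, funext fun x => ?_⟩
  exact ((e (p x)).some ⟨x, rfl⟩).2

open Classical in
-- Composing with the inverse of one solution `σ` turns the solutions into the permutations of `X`
-- that stabilise `q ∘ σ`, i.e. permute each fibre. A bijection preserves fibre sizes, so unequal
-- sizes leave no solution.
theorem card_equiv_comp_eq {X Y T : Type*} [Fintype X] [Fintype Y] [Fintype T] [DecidableEq T]
    (p : X → T) (q : Y → T) :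
    (Finset.univ.filter fun σ : X ≃ Y => q ∘ σ = p).card =
      if ∀ t, fiberCard p t = fiberCard q t then ∏ t, (fiberCard p t)! else 0 := by
  split_ifs with h
  · obtain ⟨σ, rfl⟩ := exists_equiv_comp_eq p q h
    have := DomMulAct.stabilizer_card (f := q ∘ σ)
    simp only [Fintype.card_subtype] at this
    simp only [fiberCard]
    rw [← this]
    refine Finset.card_equiv (Equiv.equivCongr (Equiv.refl X) σ.symm) fun τ => ?_
    simp only [Finset.mem_filter, Finset.mem_univ, true_and, funext_iff]
    simp
  · refine Finset.card_eq_zero.2 (Finset.filter_eq_empty_iff.2 fun σ _ hσ => h fun t => ?_)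
    subst hσ
    exact Finset.card_equiv σ (by simp)

theorem fiberCard_exists {X T : Type*} [Fintype X] [Fintype T] [DecidableEq T]
    (c : T → ℕ) (h : ∑ t, c t = Fintype.card X) : ∃ q : X → T, fiberCard q = c := by
  have : Fintype.card X = Fintype.card (Σ t, Fin (c t)) := by simp [h]
  let e := Fintype.equivOfCardEq this
  refine ⟨fun x => (e x).1, funext fun t => ?_⟩
  have : fiberCard (fun x => (e x).1) t = Fintype.card (Fin (c t)) := by
    rw [fiberCard, ← Fintype.card_subtype]
    exact Fintype.card_congr ((e.subtypeEquiv (q := fun s => s.1 = t) fun _ => Iff.rfl).trans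
      (Equiv.sigmaSubtype t))
  simpa using this

open Classical in
/-- The number of functions with prescribed fibre cardinalities is a multinomial coefficient. -/
theorem card_fiberCard_eq {X T : Type*} [Fintype X] [Fintype T] [DecidableEq T]
    (c : T → ℕ) (h : ∑ t, c t = Fintype.card X) :
    (Finset.univ.filter fun p : X → T => fiberCard p = c).card =
      Nat.multinomial Finset.univ c := by
  obtain ⟨q, hq⟩ := fiberCard_exists c h
  -- Permutations `σ` are sorted by `q ∘ σ`: every function with fibre sizes `c` arises from exactly
  -- `∏ t, (c t)!` of them, and no other function arises.
  have h1 : Fintype.card (Equiv.Perm X) = ∑ p : X → T,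
      (Finset.univ.filter fun σ : X ≃ X => q ∘ σ = p).card := by
    rw [← Finset.card_univ]
    exact Finset.card_eq_sum_card_fiberwise (f := fun σ : X ≃ X => q ∘ σ)
      fun _ _ => Finset.mem_coe.2 (Finset.mem_univ _)
  simp_rw [card_equiv_comp_eq, hq, ← funext_iff] at h1
  rw [← Finset.sum_filter, Fintype.card_perm, ← h] at h1
  have h2 := Nat.multinomial_spec Finset.univ c
  rw [h1, Finset.sum_congr rfl (g := fun _ => ∏ t, (c t)!), Finset.sum_const, smul_eq_mul,
    mul_comm] at h2
  · exact (Nat.eq_of_mul_eq_mul_right (Finset.prod_pos fun _ _ => Nat.factorial_pos _) h2).symm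
  · intro p hp
    rw [(Finset.mem_filter.1 hp).2]

/-! ### Generating functions of the rows -/

section RowSums

variable {S T R : Type*} [Fintype S] [DecidableEq S] [CommRing R]

theorem sum_piFinset_const_prod (A : Finset T) (w : T → R) :
    ∑ x ∈ Fintype.piFinset (fun _ : S => A), ∏ s, w (x s) = (∑ t ∈ A, w t) ^ Fintype.card S := by
  rw [← Finset.prod_univ_sum]
  simp

variable [Fintype T] [DecidableEq T]

/-- The functions taking the value `c` once and the value `d` elsewhere. -/
def singlePoint (S : Type*) [Fintype S] [DecidableEq S] (c d : T) : Finset (S → T) :=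
  Finset.univ.filter fun x => ∃ s, x s = c ∧ ∀ s', s' ≠ s → x s' = d

theorem mem_singlePoint {c d : T} {x : S → T} :
    x ∈ singlePoint S c d ↔ ∃ s, x s = c ∧ ∀ s', s' ≠ s → x s' = d := by
  simp [singlePoint]

/-- As `c ≠ d`, the exceptional point is determined by the function, so there is one function for
each element of `S`, all of equal weight. -/
theorem sum_singlePoint_prod {c d : T} (hcd : c ≠ d) (w : T → R) :
    ∑ x ∈ singlePoint S c d, ∏ s, w (x s) =
      (Fintype.card S : R) * (w c * w d ^ (Fintype.card S - 1)) := by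
  have h : singlePoint S c d =
      Finset.univ.image fun s : S => Function.update (fun _ => d) s c := by
    ext x
    simp only [mem_singlePoint, Finset.mem_univ, true_and, Finset.mem_image]
    refine exists_congr fun s => ?_
    rw [Function.update_eq_iff]
    exact and_congr eq_comm (forall₂_congr fun _ _ => eq_comm)
  rw [h, Finset.sum_image]
  · have : ∀ s : S, ∏ s', w (Function.update (fun _ => d) s c s') =
        w c * w d ^ (Fintype.card S - 1) := by
      intro s
      rw [← Finset.mul_prod_erase _ _ (Finset.mem_univ s), Function.update_self]
      congr 1
      rw [Finset.prod_congr rfl (g := fun _ => w d), Finset.prod_const,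
        Finset.card_erase_of_mem (Finset.mem_univ s), Finset.card_univ]
      intro s' hs'
      rw [Function.update_of_ne (Finset.ne_of_mem_erase hs')]
    simp [this]
  · intro s _ s' _ hs
    by_contra hne
    have : Function.update (fun _ => d) s c s = Function.update (fun _ => d) s' c s :=
      congrFun hs s
    rw [Function.update_self, Function.update_of_ne hne] at this
    exact hcd this

end RowSums

/-- The weights marking the edge ends of the items that are counted by `polyF₁` and `polyF₂`. -/
noncomputable def itemWeight : Fin 4 × Fin 3 → Polynomial (MvPolynomial (Fin 2) ℤ)
  | (0, 1) => Polynomial.X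
  | (3, 0) => Polynomial.C (MvPolynomial.X 1)
  | (3, 1) => Polynomial.C (MvPolynomial.X 0)
  | _ => 1

/-- The generating function of the rows of an item of a given class. -/
noncomputable def itemSeries (l : ℕ) : Fin 4 → Polynomial (MvPolynomial (Fin 2) ℤ) :=
  ![(polyF₁ l).map MvPolynomial.C, 1, 1, Polynomial.C (polyF₂ l)]

/-- The weights marking the edge ends of the tests that are counted by `polyG`. -/
noncomputable def testWeight : Fin 4 × Fin 3 → MvPolynomial (Fin 3) ℤ
  | (0, 1) => MvPolynomial.X 2
  | (2, 1) => MvPolynomial.X 1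
  | (3, 1) => MvPolynomial.X 0
  | _ => 1

/-- The generating function of the rows of a test of a given class. -/
noncomputable def testSeries (r : ℕ) : Fin 3 → MvPolynomial (Fin 3) ℤ :=
  ![(r : MvPolynomial (Fin 3) ℤ), polyG r, 1]

open Classical in
-- Class `0` rows take values in `{0, 1}` but are not constantly `1`, and class `3` rows are those
-- not confined to `{0, 1}`; both are differences of full boxes, whence the differences of powers in
-- `f₁` and `f₂`.
theorem sum_itemRow (l : ℕ) (c : Fin 4) :
    ∑ x : Fin l → Fin 3 with IsItemRow c x, ∏ s, itemWeight (c, x s) = itemSeries l c := by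
  have hone : ∀ c : Fin 4, (∀ x : Fin l → Fin 3, IsItemRow c x ↔ ∀ s, x s = 1) →
      itemWeight (c, 1) = 1 →
      ∑ x : Fin l → Fin 3 with IsItemRow c x, ∏ s, itemWeight (c, x s) = 1 := by
    intro c h hw
    have : (Finset.univ.filter fun x : Fin l → Fin 3 => IsItemRow c x) =
        Fintype.piFinset fun _ => {1} := by
      ext x
      rw [Finset.mem_filter]
      simp [h, funext_iff]
    rw [this, sum_piFinset_const_prod {1} fun t => itemWeight (c, t)]
    simp [hw]
  fin_cases c
  · have : (Finset.univ.filter fun x : Fin l → Fin 3 => IsItemRow 0 x) =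
        (Fintype.piFinset fun _ => {0, 1}) \ (Fintype.piFinset fun _ => {1}) := by
      ext x
      rw [Finset.mem_filter]
      simp only [IsItemRow, Finset.mem_univ, true_and, Finset.mem_sdiff,
        Fintype.mem_piFinset, Finset.mem_insert, Finset.mem_singleton, not_forall]
      have h01 : ∀ t : Fin 3, t ≠ 2 ↔ t = 0 ∨ t = 1 := by decide
      simp only [h01]
      refine and_congr_right fun h => exists_congr fun s => ?_
      have := h s
      omega
    change ∑ x : Fin l → Fin 3 with IsItemRow 0 x, ∏ s, itemWeight (0, x s) = _
    rw [this, Finset.sum_sdiff_eq_sub, sum_piFinset_const_prod _ fun t => itemWeight (0, t),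
      sum_piFinset_const_prod _ fun t => itemWeight (0, t)]
    · simp [itemWeight, itemSeries, polyF₁]
    · exact Fintype.piFinset_subset _ _ fun _ => by simp
  · exact hone 1 (fun _ => Iff.rfl) rfl
  · exact hone 2 (fun _ => Iff.rfl) rfl
  · have : (Finset.univ.filter fun x : Fin l → Fin 3 => IsItemRow 3 x) =
        (Fintype.piFinset fun _ => Finset.univ) \ (Fintype.piFinset fun _ => {0, 1}) := by
      ext x
      rw [Finset.mem_filter]
      simp only [IsItemRow, Finset.mem_univ, true_and, Finset.mem_sdiff,
        Fintype.mem_piFinset, Finset.mem_insert, Finset.mem_singleton, not_forall,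
        implies_true]
      refine exists_congr fun s => ?_
      omega
    change ∑ x : Fin l → Fin 3 with IsItemRow 3 x, ∏ s, itemWeight (3, x s) = _
    rw [this, Finset.sum_sdiff_eq_sub, sum_piFinset_const_prod _ fun t => itemWeight (3, t),
      sum_piFinset_const_prod _ fun t => itemWeight (3, t)]
    · simp [itemWeight, itemSeries, polyF₂, Fin.sum_univ_three]
      ring
    · exact Fintype.piFinset_subset _ _ fun _ => by simp

open Classical in
-- For class `1`, the first difference in `g` retains the rows with a defective end. The two further
-- terms remove the rows in which this end is the only PD one, of class `1` and of class `0`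
-- respectively. For class `0`, all labels have weight `1` and only the `r` positions of the PD end
-- are counted.
theorem sum_testRow (r : ℕ) (c : Fin 3) :
    ∑ y : Fin r → Fin 4 with IsTestRow c y, ∏ s, testWeight (y s, c) = testSeries r c := by
  fin_cases c
  · have : (Finset.univ.filter fun x : Fin r → Fin 4 => IsTestRow 0 x) =
        singlePoint (Fin r) 0 3 := by
      ext x
      rw [Finset.mem_filter, mem_singlePoint]
      simp [IsTestRow]
    change ∑ y : Fin r → Fin 4 with IsTestRow 0 y, ∏ s, testWeight (y s, 0) = _
    rw [this, sum_singlePoint_prod (by decide) fun t => testWeight (t, 0)]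
    simp [testWeight, testSeries]
  · have : (Finset.univ.filter fun x : Fin r → Fin 4 => IsTestRow 1 x) =
        (((Fintype.piFinset fun _ => Finset.univ) \ (Fintype.piFinset fun _ => {2, 3})) \
          singlePoint (Fin r) 1 3) \ singlePoint (Fin r) 0 3 := by
      ext x
      rw [Finset.mem_filter]
      simp only [IsTestRow, mem_singlePoint, Finset.mem_univ, true_and,
        Finset.mem_sdiff, Fintype.mem_piFinset, Finset.mem_insert, Finset.mem_singleton,
        implies_true]
      constructor
      · rintro ⟨⟨s, hs⟩, h⟩
        refine ⟨⟨fun h' => ?_, ?_⟩, ?_⟩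
        · have := h' s
          omega
        · rintro ⟨s, -, h'⟩
          exact h ⟨s, h'⟩
        · rintro ⟨s, -, h'⟩
          exact h ⟨s, h'⟩
      · rintro ⟨⟨h1, h2⟩, h3⟩
        push Not at h1
        obtain ⟨s, hs⟩ := h1
        have hs' : x s = 0 ∨ x s = 1 := by omega
        refine ⟨⟨s, hs'⟩, ?_⟩
        rintro ⟨s', h'⟩
        have : s = s' := by
          by_contra hne
          exact hs.2 (h' s hne)
        subst this
        rcases hs' with h0 | h0
        · exact h3 ⟨s, h0, h'⟩
        · exact h2 ⟨s, h0, h'⟩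
    change ∑ y : Fin r → Fin 4 with IsTestRow 1 y, ∏ s, testWeight (y s, 1) = _
    rw [this, Finset.sum_sdiff_eq_sub, Finset.sum_sdiff_eq_sub, Finset.sum_sdiff_eq_sub,
      sum_piFinset_const_prod _ fun t => testWeight (t, 1),
      sum_piFinset_const_prod _ fun t => testWeight (t, 1),
      sum_singlePoint_prod (by decide) fun t => testWeight (t, 1),
      sum_singlePoint_prod (by decide) fun t => testWeight (t, 1)]
    · simp [testWeight, testSeries, polyG, Fin.sum_univ_four]
      ring
    · exact Fintype.piFinset_subset _ _ fun _ => by simp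
    · intro x
      simp only [mem_singlePoint, Finset.mem_univ, true_and,
        Finset.mem_sdiff, Fintype.mem_piFinset, Finset.mem_insert, Finset.mem_singleton,
        implies_true]
      rintro ⟨s, h, -⟩ h'
      have := h' s
      omega
    · intro x
      simp only [mem_singlePoint, Finset.mem_univ, true_and,
        Finset.mem_sdiff, Fintype.mem_piFinset, Finset.mem_insert, Finset.mem_singleton,
        implies_true]
      rintro ⟨s, h, hs⟩
      refine ⟨fun h' => ?_, ?_⟩
      · have := h' s
        omega
      · rintro ⟨s', h', hs'⟩
        by_cases hne : s = s'
        · subst hne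
          omega
        · have := hs' s hne
          omega
  · have : (Finset.univ.filter fun x : Fin r → Fin 4 => IsTestRow 2 x) =
        Fintype.piFinset fun _ => {3} := by
      ext x
      rw [Finset.mem_filter]
      simp [IsTestRow, funext_iff]
    change ∑ y : Fin r → Fin 4 with IsTestRow 2 y, ∏ s, testWeight (y s, 2) = _
    rw [this, sum_piFinset_const_prod {3} fun t => testWeight (t, 2)]
    simp [testWeight, testSeries]

/-! ### Row assignments with prescribed label counts -/

/-- The labels of the edge ends of the items: the class of the item and that of the test. -/
def itemLabel {V S : Type*} (u : V → Fin 4) (a : V → S → Fin 3) (e : V × S) : Fin 4 × Fin 3 :=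
  (u e.1, a e.1 e.2)

/-- The labels of the edge ends of the tests: the class of the item and that of the test. -/
def testLabel {C S : Type*} (t : C → Fin 3) (b : C → S → Fin 4) (e : C × S) : Fin 4 × Fin 3 :=
  (b e.1 e.2, t e.1)

open Classical in
/-- The valid assignments of test classes to the edge ends of items of the classes `u`. -/
noncomputable def itemRows {n : ℕ} (l : ℕ) (u : Fin n → Fin 4) : Finset (Fin n → Fin l → Fin 3) :=
  Fintype.piFinset fun v => Finset.univ.filter (IsItemRow (u v))

open Classical in
/-- The valid assignments of item classes to the edge ends of tests of the classes `t`. -/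
noncomputable def testRows {m : ℕ} (r : ℕ) (t : Fin m → Fin 3) : Finset (Fin m → Fin r → Fin 4) :=
  Fintype.piFinset fun c => Finset.univ.filter (IsTestRow (t c))

theorem mem_itemRows {n l : ℕ} {u : Fin n → Fin 4} {a : Fin n → Fin l → Fin 3} :
    a ∈ itemRows l u ↔ ∀ v, IsItemRow (u v) (a v) := by
  classical
  simp [itemRows]

theorem mem_testRows {m r : ℕ} {t : Fin m → Fin 3} {b : Fin m → Fin r → Fin 4} :
    b ∈ testRows r t ↔ ∀ c, IsTestRow (t c) (b c) := by
  classical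
  simp [testRows]

theorem sum_itemRows {n : ℕ} (l : ℕ) (u : Fin n → Fin 4) :
    ∑ a ∈ itemRows l u, ∏ t, itemWeight t ^ fiberCard (itemLabel u a) t =
      (polyF₁ l ^ fiberCard u 0).map MvPolynomial.C *
        Polynomial.C (polyF₂ l ^ fiberCard u 3) := by
  have h1 : ∀ a : Fin n → Fin l → Fin 3, ∏ t, itemWeight t ^ fiberCard (itemLabel u a) t =
      ∏ v, ∏ s, itemWeight (u v, a v s) := by
    intro a
    rw [← prod_comp_eq_prod_pow_fiberCard, Fintype.prod_prod_type]
    rfl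
  simp_rw [h1, itemRows]
  rw [← Finset.prod_univ_sum _ fun v (x : Fin l → Fin 3) => ∏ s, itemWeight (u v, x s)]
  simp_rw [sum_itemRow]
  rw [prod_comp_eq_prod_pow_fiberCard]
  simp [Fin.prod_univ_four, itemSeries]

theorem sum_testRows {m : ℕ} (r : ℕ) (t : Fin m → Fin 3) :
    ∑ b ∈ testRows r t, ∏ x, testWeight x ^ fiberCard (testLabel t b) x =
      (r : MvPolynomial (Fin 3) ℤ) ^ fiberCard t 0 * polyG r ^ fiberCard t 1 := by
  have h1 : ∀ b : Fin m → Fin r → Fin 4, ∏ x, testWeight x ^ fiberCard (testLabel t b) x =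
      ∏ c, ∏ s, testWeight (b c s, t c) := by
    intro b
    rw [← prod_comp_eq_prod_pow_fiberCard, Fintype.prod_prod_type]
    rfl
  simp_rw [h1, testRows]
  rw [← Finset.prod_univ_sum _ fun c (x : Fin r → Fin 4) => ∏ s, testWeight (x s, t c)]
  simp_rw [sum_testRow]
  rw [prod_comp_eq_prod_pow_fiberCard]
  simp [Fin.prod_univ_three, testSeries]

/-- Each assignment contributes a monic monomial whose exponents are the three marked counts, so a
coefficient of the generating function counts assignments. The unmarked counts need no variable,
since the class sizes and the row conditions fix them. -/
theorem card_itemRows {n : ℕ} (l : ℕ) (u : Fin n → Fin 4) (x y z : ℕ) :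
    (((itemRows l u).filter fun a => fiberCard (itemLabel u a) (0, 1) = x ∧
        fiberCard (itemLabel u a) (3, 1) = y ∧ fiberCard (itemLabel u a) (3, 0) = z).card : ℤ) =
      (polyF₁ l ^ fiberCard u 0).coeff x *
        MvPolynomial.coeff (Finsupp.single 0 y + Finsupp.single 1 z)
          (polyF₂ l ^ fiberCard u 3) := by
  have h := congrArg (fun q => MvPolynomial.coeff
    (Finsupp.single 0 y + Finsupp.single 1 z) (q.coeff x)) (sum_itemRows l u)
  simp only [Polynomial.coeff_mul_C, Polynomial.coeff_map, MvPolynomial.coeff_C_mul,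
    Polynomial.finsetSum_coeff, MvPolynomial.coeff_sum] at h
  rw [← h, Finset.card_filter]
  push_cast
  refine Finset.sum_congr rfl fun a _ => ?_
  generalize fiberCard (itemLabel u a) = c
  have : ∏ t, itemWeight t ^ c t = Polynomial.X ^ c (0, 1) *
      Polynomial.C (MvPolynomial.monomial
        (Finsupp.single 0 (c (3, 1)) + Finsupp.single 1 (c (3, 0))) 1) := by
    -- Writing the coefficient as `1 * 1` allows the monomial to split into powers of single
    -- variables.
    rw [← mul_one (1 : ℤ), ← MvPolynomial.monomial_mul, ← MvPolynomial.X_pow_eq_monomial,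
      ← MvPolynomial.X_pow_eq_monomial]
    simp [Fintype.prod_prod_type, Fin.prod_univ_four, Fin.prod_univ_three, itemWeight]
    ring
  rw [this, Polynomial.coeff_mul_C, Polynomial.coeff_X_pow, ite_mul, zero_mul, one_mul]
  by_cases hx : c (0, 1) = x
  · rw [if_pos hx.symm, MvPolynomial.coeff_monomial]
    simp [hx, Finsupp.ext_iff, Fin.forall_fin_two]
  · rw [if_neg (Ne.symm hx)]
    simp [hx]

theorem card_testRows {m : ℕ} (r : ℕ) (t : Fin m → Fin 3) (x y z : ℕ) :
    (((testRows r t).filter fun b => fiberCard (testLabel t b) (3, 1) = x ∧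
        fiberCard (testLabel t b) (2, 1) = y ∧ fiberCard (testLabel t b) (0, 1) = z).card : ℤ) =
      (r : ℤ) ^ fiberCard t 0 *
        MvPolynomial.coeff (Finsupp.single 0 x + Finsupp.single 1 y + Finsupp.single 2 z)
          (polyG r ^ fiberCard t 1) := by
  have h := congrArg (MvPolynomial.coeff
    (Finsupp.single 0 x + Finsupp.single 1 y + Finsupp.single 2 z)) (sum_testRows r t)
  have hr : (r : MvPolynomial (Fin 3) ℤ) ^ fiberCard t 0 =
      MvPolynomial.C ((r : ℤ) ^ fiberCard t 0) := by simp
  rw [hr, MvPolynomial.coeff_C_mul, MvPolynomial.coeff_sum] at h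
  rw [← h, Finset.card_filter]
  push_cast
  refine Finset.sum_congr rfl fun b _ => ?_
  generalize fiberCard (testLabel t b) = c
  have : ∏ x, testWeight x ^ c x = MvPolynomial.monomial
        (Finsupp.single 0 (c (3, 1)) + Finsupp.single 1 (c (2, 1)) +
          Finsupp.single 2 (c (0, 1))) 1 := by
    rw [← mul_one (1 : ℤ), ← MvPolynomial.monomial_mul, ← mul_one (1 : ℤ),
      ← MvPolynomial.monomial_mul, ← MvPolynomial.X_pow_eq_monomial,
      ← MvPolynomial.X_pow_eq_monomial, mul_one, ← MvPolynomial.X_pow_eq_monomial]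
    simp [Fintype.prod_prod_type, Fin.prod_univ_four, Fin.prod_univ_three, testWeight]
    ring
  rw [this, MvPolynomial.coeff_monomial]
  simp [Finsupp.ext_iff, Fin.forall_fin_succ]

/-! ### Linear relations between label counts and class sizes -/

theorem fiberCard_itemLabel {V S : Type*} [Fintype V] [Fintype S] (u : V → Fin 4)
    (a : V → S → Fin 3) (x : Fin 4) (y : Fin 3) :
    fiberCard (itemLabel u a) (x, y) = ∑ v with u v = x, fiberCard (a v) y := by
  simp only [fiberCard, Finset.card_filter, Fintype.sum_prod_type, itemLabel, Prod.mk.injEq,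
    Finset.sum_filter]
  refine Finset.sum_congr rfl fun v _ => ?_
  split_ifs with h <;> simp [h]

theorem fiberCard_testLabel {C S : Type*} [Fintype C] [Fintype S] (t : C → Fin 3)
    (b : C → S → Fin 4) (x : Fin 4) (y : Fin 3) :
    fiberCard (testLabel t b) (x, y) = ∑ c with t c = y, fiberCard (b c) x := by
  simp only [fiberCard, Finset.card_filter, Fintype.sum_prod_type, testLabel, Prod.mk.injEq,
    Finset.sum_filter]
  refine Finset.sum_congr rfl fun v _ => ?_
  split_ifs with h <;> simp [h]

theorem fiberCard_eq_zero_iff {X T : Type*} [Fintype X] [DecidableEq T] {p : X → T} {t : T} :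
    fiberCard p t = 0 ↔ ∀ x, p x ≠ t := by
  simp [fiberCard, Finset.filter_eq_empty_iff]

theorem fiberCard_pos {X T : Type*} [Fintype X] [DecidableEq T] {p : X → T} (x : X) :
    1 ≤ fiberCard p (p x) :=
  Finset.card_pos.2 ⟨x, by simp⟩

theorem sum_filter_const_fiber {V T : Type*} [Fintype V] [DecidableEq T] {u : V → T} {x : T}
    {f : V → ℕ} {c : ℕ} (h : ∀ v, u v = x → f v = c) :
    ∑ v with u v = x, f v = fiberCard u x * c := by
  rw [Finset.sum_congr rfl (g := fun _ => c) fun v hv => h v (Finset.mem_filter.1 hv).2]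
  simp [fiberCard]

theorem le_sum_filter_fiber {V T : Type*} [Fintype V] [DecidableEq T] {u : V → T} {x : T}
    {f : V → ℕ} (h : ∀ v, u v = x → 1 ≤ f v) :
    fiberCard u x ≤ ∑ v with u v = x, f v := by
  rw [fiberCard, Finset.card_eq_sum_ones]
  exact Finset.sum_le_sum fun v hv => h v (Finset.mem_filter.1 hv).2

/-- The row conditions reduced to linear constraints: forbidden labels do not occur, the ends of
each class add up to its size times `l`, and each existential condition costs at least one end per
item. -/
theorem itemRows_counts {n l : ℕ} {u : Fin n → Fin 4} {a : Fin n → Fin l → Fin 3}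
    (ha : a ∈ itemRows l u) {c : Fin 4 × Fin 3 → ℕ} (hc : fiberCard (itemLabel u a) = c) :
    c (0, 0) + c (0, 1) = fiberCard u 0 * l ∧ c (0, 2) = 0 ∧
    c (1, 0) = 0 ∧ c (1, 1) = fiberCard u 1 * l ∧ c (1, 2) = 0 ∧
    c (2, 0) = 0 ∧ c (2, 1) = fiberCard u 2 * l ∧ c (2, 2) = 0 ∧
    c (3, 0) + c (3, 1) + c (3, 2) = fiberCard u 3 * l ∧
    fiberCard u 0 ≤ c (0, 0) ∧ fiberCard u 3 ≤ c (3, 2) := by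
  subst hc
  have hrow : ∀ v, IsItemRow (u v) (a v) := mem_itemRows.1 ha
  have hsum : ∀ v, fiberCard (a v) 0 + fiberCard (a v) 1 + fiberCard (a v) 2 = l := fun v => by
    simpa [Fin.sum_univ_three] using sum_fiberCard (a v)
  have htot : ∀ x, fiberCard (itemLabel u a) (x, 0) + fiberCard (itemLabel u a) (x, 1) +
      fiberCard (itemLabel u a) (x, 2) = fiberCard u x * l := by
    intro x
    rw [fiberCard_itemLabel, fiberCard_itemLabel, fiberCard_itemLabel, ← Finset.sum_add_distrib,
      ← Finset.sum_add_distrib]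
    exact sum_filter_const_fiber fun v _ => hsum v
  have hzero : ∀ x y, (∀ v, u v = x → ∀ s, a v s ≠ y) → fiberCard (itemLabel u a) (x, y) = 0 := by
    intro x y h
    rw [fiberCard_itemLabel]
    exact Finset.sum_eq_zero fun v hv =>
      fiberCard_eq_zero_iff.2 (h v (Finset.mem_filter.1 hv).2)
  have hle : ∀ x y, (∀ v, u v = x → ∃ s, a v s = y) →
      fiberCard u x ≤ fiberCard (itemLabel u a) (x, y) := by
    intro x y h
    rw [fiberCard_itemLabel]
    refine le_sum_filter_fiber fun v hv => ?_
    obtain ⟨s, rfl⟩ := h v hv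
    exact fiberCard_pos s
  have z02 := hzero 0 2 fun v hv => by have := hrow v; rw [hv] at this; exact this.1
  have z10 := hzero 1 0 fun v hv s => by
    have := hrow v; rw [hv] at this; rw [this s]; decide
  have z12 := hzero 1 2 fun v hv s => by
    have := hrow v; rw [hv] at this; rw [this s]; decide
  have z20 := hzero 2 0 fun v hv s => by
    have := hrow v; rw [hv] at this; rw [this s]; decide
  have z22 := hzero 2 2 fun v hv s => by
    have := hrow v; rw [hv] at this; rw [this s]; decide
  have l00 := hle 0 0 fun v hv => by have := hrow v; rw [hv] at this; exact this.2
  have l32 := hle 3 2 fun v hv => by have := hrow v; rw [hv] at this; exact this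
  have t0 := htot 0
  have t1 := htot 1
  have t2 := htot 2
  have t3 := htot 3
  omega

/-- The same reduction on the test side; a test of class `0` has exactly one end of class `0` and
all others of class `3`. -/
theorem testRows_counts {m r : ℕ} {t : Fin m → Fin 3} {b : Fin m → Fin r → Fin 4}
    (hb : b ∈ testRows r t) {d : Fin 4 × Fin 3 → ℕ} (hd : fiberCard (testLabel t b) = d) :
    d (0, 0) = fiberCard t 0 ∧ d (1, 0) = 0 ∧ d (2, 0) = 0 ∧
    d (0, 0) + d (3, 0) = fiberCard t 0 * r ∧
    d (0, 1) + d (1, 1) + d (2, 1) + d (3, 1) = fiberCard t 1 * r ∧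
    fiberCard t 1 ≤ d (0, 1) + d (1, 1) ∧
    d (0, 2) = 0 ∧ d (1, 2) = 0 ∧ d (2, 2) = 0 ∧ d (3, 2) = fiberCard t 2 * r := by
  subst hd
  have hrow : ∀ c, IsTestRow (t c) (b c) := mem_testRows.1 hb
  have hsum : ∀ c, fiberCard (b c) 0 + fiberCard (b c) 1 + fiberCard (b c) 2 +
      fiberCard (b c) 3 = r := fun c => by
    simpa [Fin.sum_univ_four] using sum_fiberCard (b c)
  have htot : ∀ y, fiberCard (testLabel t b) (0, y) + fiberCard (testLabel t b) (1, y) +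
      fiberCard (testLabel t b) (2, y) + fiberCard (testLabel t b) (3, y) =
        fiberCard t y * r := by
    intro y
    rw [fiberCard_testLabel, fiberCard_testLabel, fiberCard_testLabel, fiberCard_testLabel,
      ← Finset.sum_add_distrib, ← Finset.sum_add_distrib, ← Finset.sum_add_distrib]
    exact sum_filter_const_fiber fun c _ => hsum c
  have hzero : ∀ x y, (∀ c, t c = y → ∀ s, b c s ≠ x) → fiberCard (testLabel t b) (x, y) = 0 := by
    intro x y h
    rw [fiberCard_testLabel]
    exact Finset.sum_eq_zero fun c hc =>
      fiberCard_eq_zero_iff.2 (h c (Finset.mem_filter.1 hc).2)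
  have hsingle : ∀ c, t c = 0 → fiberCard (b c) 0 = 1 ∧ ∀ s, b c s = 0 ∨ b c s = 3 := by
    intro c hc
    have := hrow c
    rw [hc] at this
    obtain ⟨s, hs, h⟩ := this
    constructor
    · refine Finset.card_eq_one.2 ⟨s, ?_⟩
      ext s'
      simp only [Finset.mem_filter, Finset.mem_univ, true_and, Finset.mem_singleton]
      refine ⟨fun h0 => ?_, fun h0 => h0 ▸ hs⟩
      by_contra hne
      have := h s' hne
      omega
    · intro s'
      by_cases hne : s' = s
      · exact Or.inl (hne ▸ hs)
      · exact Or.inr (h s' hne)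
  have e00 : fiberCard (testLabel t b) (0, 0) = fiberCard t 0 := by
    rw [fiberCard_testLabel, sum_filter_const_fiber fun c hc => (hsingle c hc).1, mul_one]
  have z10 := hzero 1 0 fun c hc s => by have := (hsingle c hc).2 s; omega
  have z20 := hzero 2 0 fun c hc s => by have := (hsingle c hc).2 s; omega
  have z02 := hzero 0 2 fun c hc s => by
    have := hrow c; rw [hc] at this; rw [this s]; decide
  have z12 := hzero 1 2 fun c hc s => by
    have := hrow c; rw [hc] at this; rw [this s]; decide
  have z22 := hzero 2 2 fun c hc s => by
    have := hrow c; rw [hc] at this; rw [this s]; decide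
  have l1 : fiberCard t 1 ≤ fiberCard (testLabel t b) (0, 1) +
      fiberCard (testLabel t b) (1, 1) := by
    rw [fiberCard_testLabel, fiberCard_testLabel, ← Finset.sum_add_distrib]
    refine le_sum_filter_fiber fun c hc => ?_
    have := hrow c
    rw [hc] at this
    obtain ⟨⟨s, h | h⟩, -⟩ := this
    · have := fiberCard_pos (p := b c) s
      rw [h] at this
      omega
    · have := fiberCard_pos (p := b c) s
      rw [h] at this
      omega
  have t0 := htot 0
  have t1 := htot 1
  have t2 := htot 2
  omega

/-! ### Matchings consistent with a given labelling -/

open Classical in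
-- A consistent matching determines the rows `a` and `b` of classes seen across its edges.
-- Conversely, the matchings inducing given valid rows are those with `testLabel p.2 b ∘ σ =
-- itemLabel p.1 a`, which `card_equiv_comp_eq` counts.
theorem card_matchings_isLabelling {n m l r : ℕ} (p : (Fin n → Fin 4) × (Fin m → Fin 3)) :
    (Finset.univ.filter fun σ : Fin n × Fin l ≃ Fin m × Fin r =>
      (PoolingGraph.ofMatching σ).IsLabelling p).card =
    ∑ a ∈ itemRows l p.1, ∑ b ∈ testRows r p.2,
      if ∀ x, fiberCard (itemLabel p.1 a) x = fiberCard (testLabel p.2 b) x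
        then ∏ x, (fiberCard (itemLabel p.1 a) x)! else 0 := by
  rw [← Finset.sum_product']
  let f : (Fin n × Fin l ≃ Fin m × Fin r) → (Fin n → Fin l → Fin 3) × (Fin m → Fin r → Fin 4) :=
    fun σ => (fun v s => p.2 (σ (v, s)).1, fun c s => p.1 (σ.symm (c, s)).1)
  rw [Finset.card_eq_sum_card_fiberwise (f := f) (t := itemRows l p.1 ×ˢ testRows r p.2)]
  · refine Finset.sum_congr rfl fun ab hab => ?_
    rw [← card_equiv_comp_eq]
    congr 1
    ext σ
    rw [Finset.mem_product, mem_itemRows, mem_testRows] at hab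
    simp only [Finset.mem_filter, Finset.mem_univ, true_and,
      PoolingGraph.isLabelling_ofMatching_iff] at hab ⊢
    constructor
    · rintro ⟨-, h⟩
      subst h
      funext e
      simp [f, testLabel, itemLabel]
    · intro h
      have h1 : ∀ e, (ab.2 (σ e).1 (σ e).2, p.2 (σ e).1) = (p.1 e.1, ab.1 e.1 e.2) := congrFun h
      have hf : f σ = ab := by
        refine Prod.ext (funext₂ fun v s => ?_) (funext₂ fun c s => ?_)
        · exact congrArg Prod.snd (h1 (v, s))
        · have := congrArg Prod.fst (h1 (σ.symm (c, s)))
          simpa using this.symm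
      refine ⟨?_, hf⟩
      rw [← hf] at hab
      exact hab
  · intro σ hσ
    rw [Finset.mem_coe, Finset.mem_filter, PoolingGraph.isLabelling_ofMatching_iff] at hσ
    rw [Finset.mem_coe, Finset.mem_product, mem_itemRows, mem_testRows]
    exact hσ.2

/-- Every inequality of the index set follows from the two systems of linear constraints once the
label counts on both sides agree. -/
theorem mem_indexSetDD_of_counts {n m l r i j k b₁ b₂ : ℕ} (hr : 0 < r)
    {u : Fin n → Fin 4} {t : Fin m → Fin 3} (h0 : fiberCard u 0 = i) (h1 : fiberCard u 1 = j)
    (h2 : fiberCard u 2 = k) (g0 : fiberCard t 0 = b₁) (g1 : fiberCard t 1 = b₂)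
    {a : Fin n → Fin l → Fin 3} (ha : a ∈ itemRows l u)
    {b : Fin m → Fin r → Fin 4} (hb : b ∈ testRows r t)
    (h : ∀ x, fiberCard (itemLabel u a) x = fiberCard (testLabel t b) x) :
    (k, b₁, b₂) ∈ indexSetDD n m l r i j := by
  have hu : fiberCard u 0 + fiberCard u 1 + fiberCard u 2 + fiberCard u 3 = n := by
    simpa [Fin.sum_univ_four] using sum_fiberCard u
  have ht : fiberCard t 0 + fiberCard t 1 + fiberCard t 2 = m := by
    simpa [Fin.sum_univ_three] using sum_fiberCard t
  have ca := itemRows_counts ha rfl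
  have cb := testRows_counts hb rfl
  simp only [h] at ca
  generalize fiberCard (testLabel t b) = d at ca cb
  rw [h0, h1, h2] at hu ca
  rw [g0, g1] at ht cb
  generalize fiberCard u 3 = N at hu ca
  generalize fiberCard t 2 = b₀ at ht cb
  have e1 : n - i - j - k = N := by omega
  have e2 : m - b₁ - b₂ = b₀ := by omega
  -- This removes the truncated `r - 1`; after expansion the products act as atoms and the system is
  -- linear.
  obtain ⟨r, rfl⟩ : ∃ r', r = r' + 1 := ⟨r - 1, by omega⟩
  simp only [indexSetDD, Finset.mem_filter, Finset.mem_product, Finset.mem_range, e1, e2,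
    Nat.add_mul, Nat.mul_add, Nat.add_sub_cancel, Nat.mul_one] at ca cb ⊢
  omega

/-- The marked counts suffice: given them, the row relations fix the remaining ones, and `hnm` makes
the values of the pair `(3, 2)` agree on the two sides. This splits equality of labels into a
condition on `a` and one on `b`, so the double sum over rows factors. -/
theorem counts_eq_iff {n m l r i j k b₁ b₂ : ℕ} (hr : 0 < r) (hnm : n * l = m * r)
    {u : Fin n → Fin 4} {t : Fin m → Fin 3} (h0 : fiberCard u 0 = i) (h1 : fiberCard u 1 = j)
    (h2 : fiberCard u 2 = k) (g0 : fiberCard t 0 = b₁) (g1 : fiberCard t 1 = b₂)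
    (hmem : (k, b₁, b₂) ∈ indexSetDD n m l r i j)
    {a : Fin n → Fin l → Fin 3} (ha : a ∈ itemRows l u)
    {b : Fin m → Fin r → Fin 4} (hb : b ∈ testRows r t)
    {c d : Fin 4 × Fin 3 → ℕ} (hc : fiberCard (itemLabel u a) = c)
    (hd : fiberCard (testLabel t b) = d) :
    ((∀ x, c x = d x) ↔
      (c (0, 1) = i * l - b₁ ∧ c (3, 1) = b₂ * r + b₁ - (i + j + k) * l ∧
        c (3, 0) = b₁ * (r - 1)) ∧
      (d (3, 1) = b₂ * r + b₁ - (i + j + k) * l ∧ d (2, 1) = k * l ∧ d (0, 1) = i * l - b₁)) ∧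
    ((∀ x, c x = d x) → ∏ x, (c x)! = ∏ x, (![(m - b₁ - b₂) * r, j * l,
      b₂ * r + b₁ - (i + j + k) * l, b₁ * (r - 1), k * l, i * l - b₁, b₁] x)!) := by
  have hu : fiberCard u 0 + fiberCard u 1 + fiberCard u 2 + fiberCard u 3 = n := by
    simpa [Fin.sum_univ_four] using sum_fiberCard u
  have ht : fiberCard t 0 + fiberCard t 1 + fiberCard t 2 = m := by
    simpa [Fin.sum_univ_three] using sum_fiberCard t
  have ca := itemRows_counts ha hc
  have cb := testRows_counts hb hd
  rw [h0, h1, h2] at hu ca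
  rw [g0, g1] at ht cb
  generalize fiberCard u 3 = N at hu ca
  generalize fiberCard t 2 = b₀ at ht cb
  have e1 : n - i - j - k = N := by omega
  have e2 : m - b₁ - b₂ = b₀ := by omega
  subst hu ht
  obtain ⟨r, rfl⟩ : ∃ r', r = r' + 1 := ⟨r - 1, by omega⟩
  simp only [indexSetDD, Finset.mem_filter, Finset.mem_product, Finset.mem_range, e1, e2,
    Nat.add_mul, Nat.mul_add, Nat.add_sub_cancel, Nat.mul_one] at ca cb hmem hnm ⊢
  have hall : (∀ x, c x = d x) ↔ (c (0, 0) = d (0, 0) ∧ c (0, 1) = d (0, 1) ∧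
      c (0, 2) = d (0, 2)) ∧ (c (1, 0) = d (1, 0) ∧ c (1, 1) = d (1, 1) ∧
      c (1, 2) = d (1, 2)) ∧ (c (2, 0) = d (2, 0) ∧ c (2, 1) = d (2, 1) ∧
      c (2, 2) = d (2, 2)) ∧ (c (3, 0) = d (3, 0) ∧ c (3, 1) = d (3, 1) ∧
      c (3, 2) = d (3, 2)) := by
    simp [Prod.forall, Fin.forall_fin_succ]
  rw [hall]
  refine ⟨by omega, fun h => ?_⟩
  have w00 : c (0, 0) = b₁ := by omega
  have w01 : c (0, 1) = i * l - b₁ := by omega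
  have w02 : c (0, 2) = 0 := by omega
  have w10 : c (1, 0) = 0 := by omega
  have w11 : c (1, 1) = j * l := by omega
  have w12 : c (1, 2) = 0 := by omega
  have w20 : c (2, 0) = 0 := by omega
  have w21 : c (2, 1) = k * l := by omega
  have w22 : c (2, 2) = 0 := by omega
  have w30 : c (3, 0) = b₁ * r := by omega
  have w31 : c (3, 1) = b₂ * r + b₂ + b₁ - (i * l + j * l + k * l) := by omega
  have w32 : c (3, 2) = b₀ * r + b₀ := by omega
  rw [Fintype.prod_prod_type]
  simp only [Fin.prod_univ_succ, Fin.prod_univ_zero, Matrix.cons_val_zero, Matrix.cons_val_succ,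
    Fin.succ_zero_eq_one, Fin.succ_one_eq_two, Fin.reduceSucc, w00, w01, w02, w10, w11, w12, w20,
    w21, w22, w30, w31, w32, Nat.factorial_zero]
  ring

open Classical in
theorem card_matchings_isLabelling_of_mem {n m l r i j k b₁ b₂ : ℕ} (hr : 0 < r)
    (hnm : n * l = m * r) (p : (Fin n → Fin 4) × (Fin m → Fin 3))
    (h0 : fiberCard p.1 0 = i) (h1 : fiberCard p.1 1 = j)
    (h2 : fiberCard p.1 2 = k) (g0 : fiberCard p.2 0 = b₁) (g1 : fiberCard p.2 1 = b₂)
    (hmem : (k, b₁, b₂) ∈ indexSetDD n m l r i j) :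
    ((Finset.univ.filter fun σ : Fin n × Fin l ≃ Fin m × Fin r =>
      (PoolingGraph.ofMatching σ).IsLabelling p).card : ℚ) =
    (((polyF₁ l ^ i).coeff (i * l - b₁) : ℤ) : ℚ)
      * (r : ℚ) ^ b₁
      * ((MvPolynomial.coeff
            (Finsupp.single 0 (b₂ * r + b₁ - (i + j + k) * l)
              + Finsupp.single 1 (b₁ * (r - 1)))
            (polyF₂ l ^ (n - i - j - k)) : ℤ) : ℚ)
      * ((MvPolynomial.coeff
            (Finsupp.single 0 (b₂ * r + b₁ - (i + j + k) * l)
              + Finsupp.single 1 (k * l)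
              + Finsupp.single 2 (i * l - b₁))
            (polyG r ^ b₂) : ℤ) : ℚ)
      * ((n * l)! / (Nat.multinomial Finset.univ
          ![(m - b₁ - b₂) * r, j * l, b₂ * r + b₁ - (i + j + k) * l, b₁ * (r - 1),
            k * l, i * l - b₁, b₁] : ℚ)) := by
  have hu : fiberCard p.1 0 + fiberCard p.1 1 + fiberCard p.1 2 + fiberCard p.1 3 = n := by
    simpa [Fin.sum_univ_four] using sum_fiberCard p.1
  have h3 : n - i - j - k = fiberCard p.1 3 := by omega
  set v : Fin 7 → ℕ := ![(m - b₁ - b₂) * r, j * l, b₂ * r + b₁ - (i + j + k) * l, b₁ * (r - 1),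
            k * l, i * l - b₁, b₁] with hv
  -- The seven entries add up to `m * r`; membership in the index set ensures that no subtraction
  -- truncates.
  have hvsum : ∑ x, v x = n * l := by
    obtain ⟨r, rfl⟩ : ∃ r', r = r' + 1 := ⟨r - 1, by omega⟩
    have hm : ∃ b₀, m = b₁ + b₂ + b₀ := by
      simp only [indexSetDD, Finset.mem_filter] at hmem
      exact ⟨m - b₁ - b₂, by omega⟩
    obtain ⟨b₀, rfl⟩ := hm
    have e2 : b₁ + b₂ + b₀ - b₁ - b₂ = b₀ := by omega
    simp only [hv, Fin.sum_univ_succ, Fin.sum_univ_zero, Matrix.cons_val_zero,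
      Matrix.cons_val_succ, e2]
    simp only [indexSetDD, Finset.mem_filter, Finset.mem_product, Finset.mem_range, e2,
      Nat.add_mul, Nat.mul_add, Nat.add_sub_cancel, Nat.mul_one] at hmem hnm ⊢
    omega
  have hfac : ((∏ x, (v x)! : ℕ) : ℚ) = (n * l)! / (Nat.multinomial Finset.univ v : ℚ) := by
    rw [← hvsum, ← Nat.multinomial_spec, Nat.cast_mul, mul_div_cancel_right₀]
    exact Nat.cast_ne_zero.2 (Nat.multinomial_pos _ _).ne'
  rw [← hfac, card_matchings_isLabelling]
  have hA := card_itemRows l p.1 (i * l - b₁) (b₂ * r + b₁ - (i + j + k) * l) (b₁ * (r - 1))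
  have hB := card_testRows r p.2 (b₂ * r + b₁ - (i + j + k) * l) (k * l) (i * l - b₁)
  have hsum : (∑ a ∈ itemRows l p.1, ∑ b ∈ testRows r p.2,
      if ∀ x, fiberCard (itemLabel p.1 a) x = fiberCard (testLabel p.2 b) x
        then ∏ x, (fiberCard (itemLabel p.1 a) x)! else 0) =
      ((itemRows l p.1).filter fun a => fiberCard (itemLabel p.1 a) (0, 1) = i * l - b₁ ∧
        fiberCard (itemLabel p.1 a) (3, 1) = b₂ * r + b₁ - (i + j + k) * l ∧
        fiberCard (itemLabel p.1 a) (3, 0) = b₁ * (r - 1)).card *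
      ((testRows r p.2).filter fun b =>
        fiberCard (testLabel p.2 b) (3, 1) = b₂ * r + b₁ - (i + j + k) * l ∧
        fiberCard (testLabel p.2 b) (2, 1) = k * l ∧
        fiberCard (testLabel p.2 b) (0, 1) = i * l - b₁).card * ∏ x, (v x)! := by
    rw [Finset.card_filter, Finset.card_filter, Finset.sum_mul_sum, Finset.sum_mul]
    refine Finset.sum_congr rfl fun a ha => ?_
    rw [Finset.sum_mul]
    refine Finset.sum_congr rfl fun b hb => ?_
    obtain ⟨hiff, hprod⟩ := counts_eq_iff hr hnm h0 h1 h2 g0 g1 hmem ha hb rfl rfl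
    by_cases h : ∀ x, fiberCard (itemLabel p.1 a) x = fiberCard (testLabel p.2 b) x
    · rw [if_pos h, hprod h, if_pos (hiff.1 h).1, if_pos (hiff.1 h).2, one_mul, one_mul]
    · rw [if_neg h]
      rw [hiff, not_and_or] at h
      rcases h with h | h <;> simp only [if_neg h, zero_mul, mul_zero]
  rw [hsum]
  rw [h0, ← h3] at hA
  rw [g0, g1] at hB
  have hA' := congrArg (Int.cast : ℤ → ℚ) hA
  have hB' := congrArg (Int.cast : ℤ → ℚ) hB
  push_cast at hA' hB' ⊢
  rw [hA', hB']
  ring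

open Classical in
theorem card_matchings_isLabelling_of_notMem {n m l r i j k b₁ b₂ : ℕ} (hr : 0 < r)
    (p : (Fin n → Fin 4) × (Fin m → Fin 3))
    (h0 : fiberCard p.1 0 = i) (h1 : fiberCard p.1 1 = j)
    (h2 : fiberCard p.1 2 = k) (g0 : fiberCard p.2 0 = b₁) (g1 : fiberCard p.2 1 = b₂)
    (hmem : (k, b₁, b₂) ∉ indexSetDD n m l r i j) :
    (Finset.univ.filter fun σ : Fin n × Fin l ≃ Fin m × Fin r =>
      (PoolingGraph.ofMatching σ).IsLabelling p).card = 0 := by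
  rw [card_matchings_isLabelling]
  refine Finset.sum_eq_zero fun a ha => Finset.sum_eq_zero fun b hb => if_neg fun h => ?_
  exact hmem (mem_indexSetDD_of_counts hr h0 h1 h2 g0 g1 ha hb h)

/-! ### Summation over all labellings -/

theorem card_labellings {n m i j k b₁ b₂ : ℕ} (hn : i + j + k ≤ n) (hm : b₁ + b₂ ≤ m) :
    (Finset.univ.filter fun p : (Fin n → Fin 4) × (Fin m → Fin 3) =>
      (fiberCard p.1 0 = i ∧ fiberCard p.1 1 = j) ∧
        (fiberCard p.1 2, fiberCard p.2 0, fiberCard p.2 1) = (k, b₁, b₂)).card =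
      Nat.multinomial Finset.univ ![i, j, k, n - i - j - k] *
        Nat.multinomial Finset.univ ![b₁, b₂, m - b₁ - b₂] := by
  classical
  rw [← card_fiberCard_eq (X := Fin n), ← card_fiberCard_eq (X := Fin m), ← Finset.card_product]
  · congr 1
    ext p
    have hu : fiberCard p.1 0 + fiberCard p.1 1 + fiberCard p.1 2 + fiberCard p.1 3 = n := by
      simpa [Fin.sum_univ_four] using sum_fiberCard p.1
    have ht : fiberCard p.2 0 + fiberCard p.2 1 + fiberCard p.2 2 = m := by
      simpa [Fin.sum_univ_three] using sum_fiberCard p.2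
    simp only [Finset.mem_filter, Finset.mem_univ, true_and, Finset.mem_product, Prod.mk.injEq,
      funext_iff, Fin.forall_fin_succ, Matrix.cons_val_zero,
      Matrix.cons_val_succ, Fin.succ_zero_eq_one, Fin.succ_one_eq_two, Fin.reduceSucc,
      IsEmpty.forall_iff, and_true]
    omega
  · simp [Fin.sum_univ_three]
    omega
  · simp [Fin.sum_univ_four]
    omega

open Classical in
theorem sum_numPatternsDD (n m l r i j : ℕ) :
    ∑ σ : Fin n × Fin l ≃ Fin m × Fin r,
      (PoolingGraph.ofMatching σ).numPatternsDD (i + j) j =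
    ∑ p : (Fin n → Fin 4) × (Fin m → Fin 3) with fiberCard p.1 0 = i ∧ fiberCard p.1 1 = j,
      (Finset.univ.filter fun σ : Fin n × Fin l ≃ Fin m × Fin r =>
        (PoolingGraph.ofMatching σ).IsLabelling p).card := by
  refine Eq.trans (Finset.sum_congr rfl fun σ _ => ?_)
    (Finset.sum_card_bipartiteAbove_eq_sum_card_bipartiteBelow
      (fun σ p => (PoolingGraph.ofMatching σ).IsLabelling p))
  rw [PoolingGraph.numPatternsDD_eq_card_labellings]
  congr 1
  ext p
  rw [Finset.mem_filter, Finset.mem_bipartiteAbove, Finset.mem_filter]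
  simp only [Finset.mem_univ, true_and, fiberCard]
  exact and_comm

theorem lemma3 (n m l r : ℕ) (hl : 0 < l) (hr : 0 < r) (hnm : n * l = m * r) (i j : ℕ) :
    avgEnumeratorDD n m l r (i + j) j =
      ∑ t ∈ indexSetDD n m l r i j,
        let k := t.1
        let b₁ := t.2.1
        let b₂ := t.2.2
        (Nat.multinomial Finset.univ ![i, j, k, n - i - j - k] : ℚ)
          * (Nat.multinomial Finset.univ ![b₁, b₂, m - b₁ - b₂] : ℚ)
          * (((polyF₁ l ^ i).coeff (i * l - b₁) : ℤ) : ℚ)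
          * (r : ℚ) ^ b₁
          * ((MvPolynomial.coeff
                (Finsupp.single 0 (b₂ * r + b₁ - (i + j + k) * l)
                  + Finsupp.single 1 (b₁ * (r - 1)))
                (polyF₂ l ^ (n - i - j - k)) : ℤ) : ℚ)
          * ((MvPolynomial.coeff
                (Finsupp.single 0 (b₂ * r + b₁ - (i + j + k) * l)
                  + Finsupp.single 1 (k * l)
                  + Finsupp.single 2 (i * l - b₁))
                (polyG r ^ b₂) : ℤ) : ℚ)
          / (Nat.multinomial Finset.univ
              ![(m - b₁ - b₂) * r, j * l, b₂ * r + b₁ - (i + j + k) * l, b₁ * (r - 1),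
                k * l, i * l - b₁, b₁] : ℚ) := by
  classical
  have hcard : Fintype.card (Fin n × Fin l ≃ Fin m × Fin r) = (n * l)! := by
    rw [Fintype.card_equiv (Fintype.equivOfCardEq (by simp [hnm]))]
    simp
  have hfac : ((n * l)! : ℚ) ≠ 0 := Nat.cast_ne_zero.2 (Nat.factorial_ne_zero _)
  let P : Finset ((Fin n → Fin 4) × (Fin m → Fin 3)) :=
    Finset.univ.filter fun p => fiberCard p.1 0 = i ∧ fiberCard p.1 1 = j
  let N : (Fin n → Fin 4) × (Fin m → Fin 3) → ℕ := fun p =>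
    (Finset.univ.filter fun σ : Fin n × Fin l ≃ Fin m × Fin r =>
      (PoolingGraph.ofMatching σ).IsLabelling p).card
  let key : (Fin n → Fin 4) × (Fin m → Fin 3) → ℕ × ℕ × ℕ := fun p =>
    (fiberCard p.1 2, fiberCard p.2 0, fiberCard p.2 1)
  have hsum : ∑ σ : Fin n × Fin l ≃ Fin m × Fin r,
      (PoolingGraph.ofMatching σ).numPatternsDD (i + j) j = ∑ p ∈ P, N p :=
    sum_numPatternsDD n m l r i j
  have hsplit : ∑ p ∈ P, N p =
      ∑ t ∈ indexSetDD n m l r i j, ∑ p ∈ P with key p = t, N p := by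
    rw [Finset.sum_fiberwise_eq_sum_filter]
    refine Eq.trans (Finset.sum_congr rfl fun p hp => ?_) (Finset.sum_filter _ _).symm
    obtain ⟨h0, h1⟩ := (Finset.mem_filter.1 hp).2
    split_ifs with h
    · rfl
    · exact card_matchings_isLabelling_of_notMem hr p h0 h1 rfl rfl rfl h
  have havg : avgEnumeratorDD n m l r (i + j) j = ((∑ p ∈ P, N p : ℕ) : ℚ) / (n * l)! := by
    rw [← hsum, Nat.cast_sum, ← hcard, avgEnumeratorDD]
  rw [havg, hsplit, Nat.cast_sum, Finset.sum_div]
  refine Finset.sum_congr rfl ?_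
  rintro ⟨k, b₁, b₂⟩ ht
  have hbounds : i + j + k ≤ n ∧ b₁ + b₂ ≤ m := by
    simp only [indexSetDD, Finset.mem_filter] at ht
    exact ⟨ht.2.1, ht.2.2.2.2.2.1⟩
  have hlab := card_labellings hbounds.1 hbounds.2
  -- The number of consistent matchings depends on a labelling only through its class sizes, hence
  -- is constant on each fibre of `key`.
  have hN := Finset.sum_eq_card_nsmul (s := P.filter (key · = (k, b₁, b₂)))
    (f := fun p => (N p : ℚ)) fun p hp =>
      have h := (Finset.mem_filter.1 (Finset.mem_filter.1 hp).1).2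
      have hk := Prod.mk.inj (Finset.mem_filter.1 hp).2
      have hb := Prod.mk.inj hk.2
      card_matchings_isLabelling_of_mem hr hnm p h.1 h.2 hk.1 hb.1 hb.2 ht
  rw [Nat.cast_sum, hN, Finset.filter_filter, hlab, nsmul_eq_mul]
  push_cast
  field_simp
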